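/- **Model.** Let $V$ be a finite set of node identifiers and let $G$ be a connected simple graph on $V$ with diameter $D$. In the synchronous $B$-CONGEST model, in every round each node may send to each of its neighbors one $B$-bit word (or nothing), depending on its initial knowledge, its private input, its private uniformly random seed (independent over the nodes), and the messages it has received so far. The numbers $D,B,R$ and the set $V$ are known to all nodes. In the KT1 setting a node moreover knows initially its own identifier and those of its neighbors; in the known-topology setting it knows its own identifier and $G$. In the $R$-unicast problem there are $R$ triples $(s_j,t_j,m_j)$, $1\le j\le R$, with $s_j,t_j\in V$ known to all nodes and with a secret message $m_j\in\{0,1\}^B$ given only to $s_j$; an algorithm is *correct* if, with probability $1$, every $t_j$ outputs $m_j$. A mobile eavesdropper is given by edge sets $F_1,F_2,\dots\subseteq E(G)$, unknown to the nodes; in each round $i$ it sees everything that is sent (in both directions) over the edges of $F_i$ in that round, and its view is the collection of all this over all rounds. An algorithm *leaks no information* to it if the distribution of its view is the same for any two choices $(m_j)_j$, $(m'_j)_j$ of the secret messages. **Statement.** There is an absolute constant $c$ such that for all finite $V$, all $D,B\ge 0$, and all $R\ge 0$ in 2: 1. (Unicast.) There is a randomized algorithm with at most $c\,D$ rounds that,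 for every connected graph $G$ on $V$ of diameter $D$ and all $s,t\in V$, correctly sends a message $m^*\in\{0,1\}^B$ from $s$ to $t$ and leaks no information to any mobile eavesdropper $(F_i)_i$ such that $s$ and $t$ are connected in $G\setminus F_1$ (where the sets $F_i$, $i\ge2$, are arbitrary, possibly $F_i=E(G)$ for every $i\ge 2$). The algorithm is of congestion $2$, in either of the following senses: (a) in the known-topology setting there is such an algorithm that, in every execution, sends at most two messages over each edge, counting both directions together; (b) in the KT1 setting there is such an algorithm that, in every execution, sends at most two messages over each edge in each direction. 2. (Multi-unicast.) In the KT1 setting there is a randomized algorithm with at most $c\,(D+R)$ rounds that, for every connected graph $G$ on $V$ of diameter $D$ and all pairs $(s_1,t_1),\dots,(s_R,t_R)$, correctly solves the $R$ unicast instances $(s_j,t_j,m_j)$, $m_j\in\{0,1\}^B$, in parallel and leaks no information to any mobile eavesdropper $(F_i)_i$ such that $s_j$ and $t_j$ are connected in $G\setminus F_j$ for every $j\in\{1,\dots,R\}$ (where the sets $F_i$, $i>R$, are arbitrary). -/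

import Mathlib

namespace MobileUnicast

/-- `B`-bit words. -/
abbrev Word (B : ℕ) : Type := Fin B → Bool

/-- The (public) endpoints of `R` unicast instances. -/
structure Pairs (V : Type) (R : ℕ) where
  source : Fin R → V
  target : Fin R → V

/-- The single pair `(s, t)`. -/
def Pairs.single {V : Type} (s t : V) : Pairs V 1 := ⟨fun _ => s, fun _ => t⟩

/-- What a node knows initially in the KT1 setting: its own identifier, the identifiers of its
neighbors, and the endpoints of the instances to be solved. -/
structure LocalKnowledge (V : Type) (R : ℕ) where
  self : V
  neighbors : Set V
  pairs : Pairs V R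

/-- What a node knows initially if the topology of the network is known to all nodes. -/
structure GlobalKnowledge (V : Type) (R : ℕ) where
  self : V
  graph : SimpleGraph V
  pairs : Pairs V R

/-- Initial knowledge of the node `v` of `G` in the KT1 setting. -/
def localKnowledge {V : Type} {R : ℕ} (G : SimpleGraph V) (P : Pairs V R) (v : V) :
    LocalKnowledge V R := ⟨v, G.neighborSet v, P⟩

/-- Initial knowledge of the node `v` of `G` if the topology is known. -/
def globalKnowledge {V : Type} {R : ℕ} (G : SimpleGraph V) (P : Pairs V R) (v : V) :
    GlobalKnowledge V R := ⟨v, G, P⟩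

/-- The received messages of one node: the `i`-th entry of the list maps each node `u` to the word
received from `u` in round `i` (rounds are counted from `0`), or to `none` if `u` sent nothing. -/
abbrev History (V : Type) (B : ℕ) : Type := List (V → Option (Word B))

/-- A randomized synchronous `B`-CONGEST algorithm for nodes with identifiers in `V`.
All nodes run the same program. What a node does depends only on its initial knowledge (of type
`K`), its private input (for every instance, the secret message if the node is its source), its
private random seed, and the messages it received in the earlier rounds.
In every round a node sends to each neighbor at most one `B`-bit word. -/
structure Algorithm (V K : Type) (B R : ℕ) where
  /-- the number of rounds -/
  rounds : ℕ
  /-- the finite set from which every node draws its seed, uniformly and independently -/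
  Seed : Type
  [seedFintype : Fintype Seed]
  [seedNonempty : Nonempty Seed]
  /-- the word (if any) to be sent to a given neighbor in the current round -/
  send : K → (Fin R → Option (Word B)) → Seed → History V B → V → Option (Word B)
  /-- the local output after the last round: one word for every instance -/
  output : K → (Fin R → Option (Word B)) → Seed → History V B → (Fin R → Word B)

attribute [instance] Algorithm.seedFintype Algorithm.seedNonempty

open Classical in
/-- The private input of node `v`: the message `m j` is given to the source of instance `j` only. -/
noncomputable def privateInput {V : Type} {B R : ℕ} (P : Pairs V R) (m : Fin R → Word B) (v : V) :
    Fin R → Option (Word B) :=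
  fun j => if P.source j = v then some (m j) else none

namespace Algorithm

variable {V K : Type} {B R : ℕ} (A : Algorithm V K B R) (G : SimpleGraph V) (know : V → K)
  (P : Pairs V R) (m : Fin R → Word B) (ω : V → A.Seed)

open Classical in
/-- The histories of all nodes at the beginning of round `i`, when the algorithm is executed
on `G` with secret messages `m` and random seeds `ω`. -/
noncomputable def history : ℕ → V → History V B
  | 0, _ => []
  | i + 1, v => history i v ++
      [fun u => if G.Adj u v then
          A.send (know u) (privateInput P m u) (ω u) (history i u) v else none]

open Classical in
/-- The message sent from `u` to `v` in round `i` (`none` if there is no message). -/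
noncomputable def message (i : ℕ) (u v : V) : Option (Word B) :=
  if G.Adj u v then
    A.send (know u) (privateInput P m u) (ω u) (A.history G know P m ω i u) v else none

/-- The number of messages sent from `u` to `v` during the whole execution. -/
noncomputable def load (u v : V) : ℕ :=
  ((Finset.range A.rounds).filter
    fun i => (A.message G know P m ω i u v).isSome = true).card

/-- In every execution, at most `k` messages are sent over each edge, in both directions
together. -/
def HasEdgeCongestion (k : ℕ) : Prop :=
  ∀ (m : Fin R → Word B) (ω : V → A.Seed) (u v : V), G.Adj u v →
    A.load G know P m ω u v + A.load G know P m ω v u ≤ k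

/-- In every execution, at most `k` messages are sent over each edge in each direction. -/
def HasArcCongestion (k : ℕ) : Prop :=
  ∀ (m : Fin R → Word B) (ω : V → A.Seed) (u v : V), G.Adj u v →
    A.load G know P m ω u v ≤ k

/-- In every execution, each target outputs the message of its source. -/
def Correct : Prop :=
  ∀ (m : Fin R → Word B) (ω : V → A.Seed) (j : Fin R),
    A.output (know (P.target j)) (privateInput P m (P.target j)) (ω (P.target j))
      (A.history G know P m ω A.rounds (P.target j)) j = m j

/-- What an eavesdropper who listens over the edges `F i` in round `i` observes: for all rounds `i`
and all edges in `F i`, what is sent in round `i` over the edge, in both directions. -/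
abbrev View (F : ℕ → Set (Sym2 V)) : Type :=
  (i : Fin A.rounds) → {p : V × V // s(p.1, p.2) ∈ F i} → Option (Word B)

/-- The view of the eavesdropper in the execution with seeds `ω`. -/
noncomputable def view (F : ℕ → Set (Sym2 V)) : A.View F :=
  fun i p => A.message G know P m ω i p.1.1 p.1.2

open Classical in
/-- The distribution of the view of the eavesdropper, over uniform independent seeds. -/
noncomputable def viewDist [Fintype V] (F : ℕ → Set (Sym2 V)) : PMF (A.View F) :=
  (PMF.uniformOfFintype (V → A.Seed)).map fun ω => A.view G know P m ω F

/-- Perfect security against the mobile eavesdroppers that in the `j`-th of the first `R` rounds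
leave the endpoints of the `j`-th instance connected: the distribution of the view does not depend
on the secret messages. The sets `F i` with `R ≤ i` are arbitrary, possibly all of `E(G)`. -/
def MobileSecure [Fintype V] : Prop :=
  ∀ F : ℕ → Set (Sym2 V), (∀ i, F i ⊆ G.edgeSet) →
    (∀ j : Fin R, (G.deleteEdges (F j)).Reachable (P.source j) (P.target j)) →
    ∀ m₁ m₂ : Fin R → Word B, A.viewDist G know P m₁ F = A.viewDist G know P m₂ F

end Algorithm

end MobileUnicast

/-! ### Executions, and masking by keys on the edges -/

namespace MobileUnicast

section

open Classical

variable {V K : Type} {B R : ℕ}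

/-! Words are added bitwise modulo 2. In round `j` a fresh random key is exchanged over every edge,
and each node forms a share: the sum of the keys at its edges, plus `m j` at the source. Every key
occurs in two shares, so all shares together sum to `m j` (`sum_nodeShare`). The target keeps its
share to itself. The other shares may be published: their sum is computed over a breadth-first
search tree, and the target adds its own share.

Security (`maskedAlgorithm_mobileSecure`): given two choices of messages, add the difference `m₁ j +
m₂ j` to the keys along a path from source to target that avoids `F j` (`exists_flow_of_reachable`).
Shares inside the path do not change, the change at the source offsets the change of the message,
and the share of the target is never published. The keys heard in round `j` are the same, and
everything sent later depends on the public shares only. This translation of the seeds is a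
bijection, so the distributions of the views agree, whatever is heard after the key rounds.

The sums are pipelined up the tree and then broadcast (`collected_root`, `total_eq`), in O(D + R)
rounds. For one instance the root is the target and no broadcast is needed. Each edge then carries
one key and at most one tree message; if the tree has to be built by flooding, tokens are sent only
on arcs that do not lead to a parent. -/

lemma word_add_self (w : Word B) : w + w = 0 := by
  funext i
  change w i + w i = 0
  cases w i <;> rfl

/-- The word received from `u` in round `i`, according to the history `h`. -/
def received (h : History V B) (i : ℕ) (u : V) : Option (Word B) := h[i]?.bind (· u)

namespace Algorithm

variable (A : Algorithm V K B R) (G : SimpleGraph V) (know : V → K)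
  (P : Pairs V R) (m : Fin R → Word B) (ω : V → A.Seed)

lemma history_succ (i : ℕ) (v : V) :
    A.history G know P m ω (i + 1) v =
      A.history G know P m ω i v ++ [fun u => A.message G know P m ω i u v] := rfl

lemma length_history (i : ℕ) (v : V) : (A.history G know P m ω i v).length = i := by
  induction i with
  | zero => rfl
  | succ i ih => simp [history_succ, ih]

lemma received_history (i k : ℕ) (u v : V) :
    received (A.history G know P m ω i v) k u =
      if k < i then A.message G know P m ω k u v else none := by
  induction i with
  | zero => simp [received, history]
  | succ i ih =>
    simp only [received] at ih ⊢
    rw [history_succ, List.getElem?_append, length_history]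
    rcases lt_trichotomy k i with h | rfl | h
    · rw [if_pos h, ih, if_pos h, if_pos (by omega)]
    · simp
    · rw [if_neg (by omega), if_neg (by omega), List.getElem?_eq_none (by simp; omega)]
      rfl

/-- A change of the secret messages that can be compensated by a bijective change of the random
seeds does not change the distribution of the view. -/
lemma viewDist_eq_of_equiv [Fintype V] {A : Algorithm V K B R} {G : SimpleGraph V} {know : V → K}
    {P : Pairs V R} {m₁ m₂ : Fin R → Word B} {F : ℕ → Set (Sym2 V)}
    (e : (V → A.Seed) ≃ (V → A.Seed))
    (h : ∀ ω, A.view G know P m₁ ω F = A.view G know P m₂ (e ω) F) :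
    A.viewDist G know P m₁ F = A.viewDist G know P m₂ F := by
  have he : (PMF.uniformOfFintype (V → A.Seed)).map e = PMF.uniformOfFintype (V → A.Seed) := by
    ext ω
    rw [PMF.map_apply, tsum_eq_single (e.symm ω)]
    · simp
    · intro ω' hω'
      rw [if_neg]
      rintro rfl
      simp at hω'
  unfold viewDist
  conv_rhs => rw [← he, PMF.map_comp]
  congr 1
  funext ω
  exact h ω

end Algorithm

/-- The algorithm without communication. -/
noncomputable def silentAlgorithm (V K : Type) (B R : ℕ) : Algorithm V K B R where
  rounds := 0
  Seed := Unit
  send _ _ _ _ _ := none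
  output _ inp _ _ j := (inp j).getD 0

lemma silentAlgorithm_correct (G : SimpleGraph V) (know : V → K) (P : Pairs V R)
    (h : ∀ j, P.source j = P.target j) : (silentAlgorithm V K B R).Correct G know P := by
  intro m ω j
  simp [silentAlgorithm, privateInput, h]

lemma silentAlgorithm_load (G : SimpleGraph V) (know : V → K) (P : Pairs V R)
    (m : Fin R → Word B) (ω : V → (silentAlgorithm V K B R).Seed) (u v : V) :
    (silentAlgorithm V K B R).load G know P m ω u v = 0 := by
  rfl

lemma silentAlgorithm_mobileSecure [Fintype V] (G : SimpleGraph V) (know : V → K)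
    (P : Pairs V R) : (silentAlgorithm V K B R).MobileSecure G know P := by
  intro F _ _ m₁ m₂
  refine Algorithm.viewDist_eq_of_equiv (Equiv.refl _) fun ω => ?_
  funext i
  exact i.elim0

/-- A deterministic protocol in which every node has an input `Fin R → Word B`. -/
abbrev Protocol (V K : Type) (B R : ℕ) : Type :=
  K → (Fin R → Word B) → History V B → V → Option (Word B)

namespace Protocol

variable (p : Protocol V K B R) (G : SimpleGraph V) (know : V → K) (x : V → Fin R → Word B)

/-- The histories of all nodes at the beginning of round `i` of a deterministic protocol. -/
noncomputable def history : ℕ → V → History V B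
  | 0, _ => []
  | i + 1, v => history i v ++
      [fun u => if G.Adj u v then p (know u) (x u) (history i u) v else none]

/-- The message sent from `u` to `v` in round `i` of a deterministic protocol. -/
noncomputable def message (i : ℕ) (u v : V) : Option (Word B) :=
  if G.Adj u v then p (know u) (x u) (p.history G know x i u) v else none

lemma history_succ (i : ℕ) (v : V) :
    p.history G know x (i + 1) v =
      p.history G know x i v ++ [fun u => p.message G know x i u v] := rfl

lemma length_history (i : ℕ) (v : V) : (p.history G know x i v).length = i := by
  induction i with
  | zero => rfl
  | succ i ih => simp [history_succ, ih]

lemma received_history (i k : ℕ) (u v : V) :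
    received (p.history G know x i v) k u =
      if k < i then p.message G know x k u v else none := by
  induction i with
  | zero => simp [received, history]
  | succ i ih =>
    simp only [received] at ih ⊢
    rw [history_succ, List.getElem?_append, length_history]
    rcases lt_trichotomy k i with h | rfl | h
    · rw [if_pos h, ih, if_pos h, if_pos (by omega)]
    · simp
    · rw [if_neg (by omega), if_neg (by omega), List.getElem?_eq_none (by simp; omega)]
      rfl

end Protocol

section Masked

variable [Fintype V]

/-- The share of a node for instance `j`: the sum of its private input and of the keys that were
exchanged over its incident edges in round `j`. -/
noncomputable def share (k : LocalKnowledge V R) (inp : Fin R → Option (Word B))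
    (ω : Fin R → V → Word B) (h : History V B) (j : Fin R) : Word B :=
  (inp j).getD 0 + ∑ v, if v ∈ k.neighbors then
    (if WellOrderingRel k.self v then ω j v else (received h j v).getD 0) else 0

/-- The share of a node, withheld by the target of the instance. -/
noncomputable def publicShare (k : LocalKnowledge V R) (inp : Fin R → Option (Word B))
    (ω : Fin R → V → Word B) (h : History V B) (j : Fin R) : Word B :=
  if k.pairs.target j = k.self then 0 else share k inp ω h j

/-- In round `j < R`, a random key for instance `j` is exchanged over every edge. Thereafter, a
deterministic protocol is run on the public shares. A target adds its own share to the output of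
the protocol. -/
noncomputable abbrev maskedAlgorithm (loc : K → LocalKnowledge V R) (T : ℕ) (p : Protocol V K B R)
    (out : K → (Fin R → Word B) → History V B → Fin R → Word B) : Algorithm V K B R where
  rounds := R + T
  Seed := Fin R → V → Word B
  send k inp ω h v :=
    if hi : h.length < R then
      if WellOrderingRel (loc k).self v then some (ω ⟨h.length, hi⟩ v) else none
    else p k (publicShare (loc k) inp ω h) (h.drop R) v
  output k inp ω h j :=
    share (loc k) inp ω h j + out k (publicShare (loc k) inp ω h) (h.drop R) j

/-- The key for instance `j` exchanged over the edge between `u` and `v`. -/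
noncomputable def edgeKey (ω : V → Fin R → V → Word B) (j : Fin R) (u v : V) : Word B :=
  if WellOrderingRel u v then ω u j v else ω v j u

/-- The share of the node `u`, in terms of the seeds of all nodes. -/
noncomputable def nodeShare (G : SimpleGraph V) (P : Pairs V R) (m : Fin R → Word B)
    (ω : V → Fin R → V → Word B) (u : V) (j : Fin R) : Word B :=
  (if P.source j = u then m j else 0) + ∑ v, if G.Adj u v then edgeKey ω j u v else 0

/-- The public share of the node `u`, in terms of the seeds of all nodes. -/
noncomputable def nodePublicShare (G : SimpleGraph V) (P : Pairs V R) (m : Fin R → Word B)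
    (ω : V → Fin R → V → Word B) (u : V) (j : Fin R) : Word B :=
  if P.target j = u then 0 else nodeShare G P m ω u j

omit [Fintype V] in
lemma edgeKey_comm (ω : V → Fin R → V → Word B) (j : Fin R) (u v : V) :
    edgeKey ω j u v = edgeKey ω j v u := by
  unfold edgeKey
  rcases trichotomous_of WellOrderingRel u v with h | rfl | h
  · rw [if_pos h, if_neg (asymm_of _ h)]
  · rfl
  · rw [if_neg (asymm_of _ h), if_pos h]

/-- The terms at `(u, v)` and `(v, u)` are equal and cancel in characteristic 2; the well-order
selects one term of each such pair. -/
lemma sum_sum_eq_zero_of_symm (f : V → V → Word B) (hf : ∀ u v, f u v = f v u)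
    (h0 : ∀ u, f u u = 0) : ∑ u, ∑ v, f u v = 0 := by
  have hsplit : ∀ u v, f u v = (if WellOrderingRel u v then f u v else 0) +
      (if WellOrderingRel v u then f v u else 0) := by
    intro u v
    rcases trichotomous_of WellOrderingRel u v with h | rfl | h
    · rw [if_pos h, if_neg (asymm_of _ h), add_zero]
    · simp [h0]
    · rw [if_neg (asymm_of _ h), if_pos h, zero_add, hf]
  rw [Finset.sum_congr rfl fun u _ => Finset.sum_congr rfl fun v _ => hsplit u v]
  simp only [Finset.sum_add_distrib]
  conv_lhs => rw [Finset.sum_comm]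
  exact word_add_self _

lemma sum_nodeShare (G : SimpleGraph V) (P : Pairs V R) (m : Fin R → Word B)
    (ω : V → Fin R → V → Word B) (j : Fin R) : ∑ u, nodeShare G P m ω u j = m j := by
  unfold nodeShare
  rw [Finset.sum_add_distrib, sum_sum_eq_zero_of_symm]
  · simp
  · intro u v
    simp [edgeKey_comm ω j u v, G.adj_comm]
  · simp

/-- Withholding the share of the target costs nothing: the target itself can add it to the sum of
the public shares. -/
lemma nodeShare_target_add_sum (G : SimpleGraph V) (P : Pairs V R) (m : Fin R → Word B)
    (ω : V → Fin R → V → Word B) (j : Fin R) :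
    nodeShare G P m ω (P.target j) j + ∑ u, nodePublicShare G P m ω u j = m j := by
  rw [← sum_nodeShare G P m ω j, ← Finset.add_sum_erase _ _ (Finset.mem_univ (P.target j)),
    ← Finset.add_sum_erase _ (fun u => nodeShare G P m ω u j) (Finset.mem_univ (P.target j))]
  congr 1
  rw [nodePublicShare, if_pos rfl, zero_add]
  refine Finset.sum_congr rfl fun u hu => ?_
  rw [nodePublicShare, if_neg (Finset.ne_of_mem_erase hu).symm]

section Execution

variable {G : SimpleGraph V} {know : V → K} {P : Pairs V R} {loc : K → LocalKnowledge V R}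
  (hloc : ∀ v, loc (know v) = localKnowledge G P v) (T : ℕ) (p : Protocol V K B R)
  (out : K → (Fin R → Word B) → History V B → Fin R → Word B) (m : Fin R → Word B)
  (ω : V → Fin R → V → Word B)

include hloc

lemma maskedAlgorithm_message_lt (j : Fin R) (u v : V) :
    (maskedAlgorithm loc T p out).message G know P m ω j u v =
      if G.Adj u v ∧ WellOrderingRel u v then some (ω u j v) else none := by
  have hlt : ((maskedAlgorithm loc T p out).history G know P m ω j u).length < R := by
    rw [Algorithm.length_history]; exact j.2
  have hj : (⟨_, hlt⟩ : Fin R) = j := Fin.ext (Algorithm.length_history ..)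
  by_cases hadj : G.Adj u v
  · rw [Algorithm.message, if_pos hadj]
    simp only [hadj, true_and]
    change (if hi : _ then _ else _) = _
    rw [dif_pos hlt, hj, hloc]
    rfl
  · simp [Algorithm.message, hadj]

lemma share_eq (i : ℕ) (hi : R ≤ i) (u : V) :
    share (loc (know u)) (privateInput P m u) (ω u)
      ((maskedAlgorithm loc T p out).history G know P m ω i u) = nodeShare G P m ω u := by
  funext j
  unfold share nodeShare
  congr 1
  · unfold privateInput
    split_ifs <;> rfl
  · refine Finset.sum_congr rfl fun v _ => ?_
    rw [hloc]
    change (if G.Adj u v then (if WellOrderingRel u v then _ else _) else _) = _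
    split_ifs with h1 h2
    · rw [edgeKey, if_pos h2]
    · have h3 : WellOrderingRel v u := by
        rcases trichotomous_of WellOrderingRel u v with h | h | h
        · exact absurd h h2
        · exact absurd h h1.ne
        · exact h
      rw [Algorithm.received_history, if_pos (by omega), maskedAlgorithm_message_lt hloc,
        if_pos ⟨h1.symm, h3⟩, edgeKey, if_neg h2]
      rfl
    · rfl

lemma publicShare_eq (i : ℕ) (hi : R ≤ i) (u : V) :
    publicShare (loc (know u)) (privateInput P m u) (ω u)
      ((maskedAlgorithm loc T p out).history G know P m ω i u) = nodePublicShare G P m ω u := by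
  funext j
  rw [publicShare, share_eq hloc T p out m ω i hi, hloc]
  rfl

/-- After the key rounds the execution is that of `p` on the public shares, so seeds and messages
influence later traffic only through these shares. -/
lemma drop_history (i : ℕ) (u : V) :
    ((maskedAlgorithm loc T p out).history G know P m ω (R + i) u).drop R =
      p.history G know (nodePublicShare G P m ω) i u := by
  induction i generalizing u with
  | zero => exact List.drop_eq_nil_of_le (by rw [Algorithm.length_history]; simp)
  | succ i ih =>
    rw [← add_assoc, Algorithm.history_succ, List.drop_append_of_le_length
      (by rw [Algorithm.length_history]; omega), ih, Protocol.history_succ]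
    congr 2
    funext w
    unfold Algorithm.message Protocol.message
    split_ifs with hadj
    · change (if hi : _ then _ else _) = _
      rw [dif_neg (by rw [Algorithm.length_history]; omega),
        publicShare_eq hloc T p out m ω _ (by omega), ih]
    · rfl

lemma maskedAlgorithm_message_add (i : ℕ) (u v : V) :
    (maskedAlgorithm loc T p out).message G know P m ω (R + i) u v =
      p.message G know (nodePublicShare G P m ω) i u v := by
  unfold Algorithm.message Protocol.message
  split_ifs with hadj
  · change (if hi : _ then _ else _) = _
    rw [dif_neg (by rw [Algorithm.length_history]; omega),
      publicShare_eq hloc T p out m ω _ (by omega), drop_history hloc]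
  · rfl

lemma maskedAlgorithm_correct
    (hout : ∀ (x : V → Fin R → Word B) (j : Fin R),
      out (know (P.target j)) (x (P.target j)) (p.history G know x T (P.target j)) j =
        ∑ u, x u j) :
    (maskedAlgorithm loc T p out).Correct G know P := by
  intro m ω j
  change share _ _ _ ((maskedAlgorithm loc T p out).history G know P m ω (R + T) _) j +
    out _ (publicShare _ _ _ ((maskedAlgorithm loc T p out).history G know P m ω (R + T) _))
      (((maskedAlgorithm loc T p out).history G know P m ω (R + T) _).drop R) j = _
  rw [share_eq hloc _ _ _ _ _ _ (by omega), publicShare_eq hloc _ _ _ _ _ _ (by omega),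
    drop_history hloc, hout, nodeShare_target_add_sum]

omit hloc in
/-- A word can be routed along a walk: it is added to the keys of the edges of the walk. -/
lemma exists_flow_of_reachable (H : SimpleGraph V) (w : Word B) {s t : V}
    (h : H.Reachable s t) :
    ∃ δ : Sym2 V → Word B, (∀ e, e ∉ H.edgeSet → δ e = 0) ∧
      ∀ u, ∑ v, δ s(u, v) = (if s = u then w else 0) + (if t = u then w else 0) := by
  obtain ⟨q⟩ := h
  induction q with
  | nil => exact ⟨0, by simp, fun u => by simp [word_add_self]⟩
  | @cons a b c hab q ih =>
    obtain ⟨δ, h0, hδ⟩ := ih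
    -- The walk may repeat edges: contributions are added, so repetitions cancel in pairs. At `b`
    -- the new edge cancels the endpoint term of the remaining walk.
    refine ⟨fun e => (if e = s(a, b) then w else 0) + δ e, ?_, fun u => ?_⟩
    · intro e he
      dsimp only
      rw [h0 e he, add_zero, if_neg]
      rintro rfl
      exact he hab
    · have hne : a ≠ b := hab.ne
      have hsum : ∑ v, (if s(u, v) = s(a, b) then w else 0) =
          (if a = u then w else 0) + (if b = u then w else 0) := by
        have hpt : ∀ v, (if s(u, v) = s(a, b) then w else 0) =
            (if b = v then (if a = u then w else 0) else 0) +
              (if a = v then (if b = u then w else 0) else 0) := by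
          intro v
          by_cases h1 : a = u <;> by_cases h2 : b = v <;> by_cases h3 : a = v <;>
            by_cases h4 : b = u <;> subst_vars <;> simp_all <;> tauto
        rw [Finset.sum_congr rfl fun v _ => hpt v, Finset.sum_add_distrib]
        simp
      rw [Finset.sum_add_distrib, hsum, hδ, add_assoc, ← add_assoc (if b = u then w else 0),
        word_add_self, zero_add]

/-- Translating the keys by a flow of value `m₁ j + m₂ j` from source to target outside `F j` turns
an execution with `m₁` into one with `m₂` that has the same view. -/
lemma maskedAlgorithm_mobileSecure : (maskedAlgorithm loc T p out).MobileSecure G know P := by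
  intro F _ hF m₁ m₂
  choose δ hδ0 hδ using fun j => exists_flow_of_reachable _ (m₁ j + m₂ j) (hF j)
  -- Both endpoints shift their seed entry for the edge, so the shift of `edgeKey` does not depend
  -- on which endpoint supplies the key.
  let c : V → Fin R → V → Word B := fun u j v => δ j s(u, v)
  have hkey : ∀ ω j u v, edgeKey (ω + c) j u v = edgeKey ω j u v + δ j s(u, v) := by
    intro ω j u v
    unfold edgeKey
    split_ifs
    · rfl
    · rw [Sym2.eq_swap]; rfl
  have hshare : ∀ ω, nodePublicShare G P m₁ ω = nodePublicShare G P m₂ (ω + c) := by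
    intro ω
    funext u j
    unfold nodePublicShare
    split_ifs with ht
    · rfl
    · have hsum : ∑ v, (if G.Adj u v then edgeKey (ω + c) j u v else 0) =
          (∑ v, if G.Adj u v then edgeKey ω j u v else 0) +
            (if P.source j = u then m₁ j + m₂ j else 0) := by
        have h1 := hδ j u
        rw [if_neg ht, add_zero] at h1
        rw [← h1, ← Finset.sum_add_distrib]
        refine Finset.sum_congr rfl fun v _ => ?_
        split_ifs with hadj
        · exact hkey ω j u v
        · rw [hδ0 j _ fun he => hadj (SimpleGraph.deleteEdges_le _ he), add_zero]
      unfold nodeShare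
      rw [hsum]
      split_ifs
      -- At the source, `m₂ j + (m₁ j + m₂ j) = m₁ j`.
      · have := word_add_self (m₂ j)
        rw [add_comm (Finset.sum _ _), ← add_assoc, add_comm (m₁ j) (m₂ j), ← add_assoc, this,
          zero_add]
      · simp
  refine Algorithm.viewDist_eq_of_equiv (Equiv.addRight c) fun ω => ?_
  funext i e
  change Algorithm.message _ _ _ _ _ _ _ _ _ =
    (maskedAlgorithm loc T p out).message G know P m₂ (ω + c) _ _ _
  obtain ⟨⟨u, v⟩, he⟩ := e
  by_cases hi : (i : ℕ) < R
  · have h1 := fun m ω => maskedAlgorithm_message_lt hloc T p out m ω ⟨i, hi⟩ u v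
    dsimp only at h1 ⊢
    rw [h1, h1]
    -- The edge is overheard, hence deleted from the graph that carries the flow.
    have : (ω + c) u ⟨i, hi⟩ v = ω u ⟨i, hi⟩ v := by
      change ω u ⟨i, hi⟩ v + δ _ s(u, v) = _
      rw [hδ0, add_zero]
      intro hmem
      rw [SimpleGraph.edgeSet_deleteEdges] at hmem
      exact hmem.2 he
    rw [this]
  · obtain ⟨k, hk⟩ := Nat.exists_eq_add_of_le (not_lt.mp hi)
    dsimp only
    rw [hk, maskedAlgorithm_message_add hloc, maskedAlgorithm_message_add hloc, hshare]

end Execution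

end Masked

end

end MobileUnicast

/-! ### Pipelined summation over a breadth-first search tree -/

namespace MobileUnicast

section

open Classical

variable {V K : Type} {B R : ℕ}

/-- How a node decides in the first rounds of a protocol to which neighbors to send a token, and
how it computes thereafter its depth and its parent in a spanning tree. -/
structure TreeRule (V K : Type) (B : ℕ) where
  token : K → History V B → V → Prop
  depth : K → History V B → ℕ
  parent : K → History V B → V

section Relay

variable [Fintype V] (D : ℕ) (ident root : K → V) (τ : TreeRule V K B)

/-- The sum of the inputs for instance `j` of all nodes below a node, by what it received from
its children. -/
noncomputable def subtotal (k : K) (x : Fin R → Word B) (h : History V B) (j : Fin R) : Word B :=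
  x j + ∑ u, (received h (2 * D + 2 - (τ.depth k h + 1) + j) u).getD 0

/-- The sum of the inputs for instance `j` of all nodes: computed by the root, and received from
the parent by all other nodes. -/
noncomputable def total (k : K) (x : Fin R → Word B) (h : History V B) (j : Fin R) : Word B :=
  if ident k = root k then subtotal D τ k x h j
  else (received h (2 * D + 2 + R + (τ.depth k h - 1) + j) (τ.parent k h)).getD 0

/-- After `D + 1` rounds for the construction of a spanning tree, the sums of the inputs are
collected along the tree by pipelining, and then broadcast by the root. -/
noncomputable def relay : Protocol V K B R := fun k x h v =>
  if h.length ≤ D then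
    if τ.token k h v then some 0 else none
  else if h.length < 2 * D + 2 + R then
    if hj : ident k ≠ root k ∧ v = τ.parent k h ∧
        ∃ j : Fin R, h.length + τ.depth k h = 2 * D + 2 + j then
      some (subtotal D τ k x h hj.2.2.choose)
    else none
  else if hj : ∃ j : Fin R, h.length = 2 * D + 2 + R + τ.depth k h + j then
    some (total D ident root τ k x h hj.choose)
  else none

/-- The tree rule constructs the spanning tree with root `r` in which `par v` is the parent of `v`,
and this is a breadth-first search tree of depth at most `D`. -/
structure Constructs (G : SimpleGraph V) (know : V → K) (x : V → Fin R → Word B) (r : V)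
    (par : V → V) : Prop where
  ident_eq : ∀ v, ident (know v) = v
  root_eq : ∀ v, root (know v) = r
  dist_le : ∀ v, G.dist r v ≤ D
  adj : ∀ v, v ≠ r → G.Adj v (par v)
  dist_parent : ∀ v, v ≠ r → G.dist r (par v) + 1 = G.dist r v
  depth_eq : ∀ i v, D < i →
    τ.depth (know v) ((relay D ident root τ).history G know x i v) = G.dist r v
  parent_eq : ∀ i v, D < i → v ≠ r →
    τ.parent (know v) ((relay D ident root τ).history G know x i v) = par v

variable {D ident root τ} {G : SimpleGraph V} {know : V → K} {x : V → Fin R → Word B} {r : V}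
  {par : V → V}

lemma relay_message_token (i : ℕ) (hi : i ≤ D) (u v : V) :
    (relay D ident root τ).message G know x i u v =
      if G.Adj u v ∧ τ.token (know u) ((relay D ident root τ).history G know x i u) v
      then some 0 else none := by
  unfold Protocol.message
  by_cases hadj : G.Adj u v
  · rw [if_pos hadj, relay, if_pos (by rwa [Protocol.length_history])]
    simp only [hadj, true_and]
  · simp [hadj]

/-- The value for instance `j` that the node `v` sends to its parent. -/
noncomputable def collected (D : ℕ) (ident root : K → V) (τ : TreeRule V K B) (G : SimpleGraph V)
    (know : V → K) (x : V → Fin R → Word B) (r v : V) (j : Fin R) : Word B :=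
  x v j + ∑ u, ((relay D ident root τ).message G know x
    (2 * D + 2 - (G.dist r v + 1) + j) u v).getD 0

section

variable (hτ : Constructs D ident root τ G know x r par)
include hτ

lemma subtotal_eq (v : V) (j : Fin R) (i : ℕ) (hD : D < i)
    (hi : 2 * D + 2 + j ≤ i + G.dist r v) :
    subtotal D τ (know v) (x v) ((relay D ident root τ).history G know x i v) j =
      collected D ident root τ G know x r v j := by
  unfold subtotal collected
  congr 1
  refine Finset.sum_congr rfl fun u _ => ?_
  have := hτ.dist_le v
  rw [hτ.depth_eq i v hD, Protocol.received_history, if_pos (by omega)]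

/-- A node of depth `d` reads the values of its children in round `2 * D + 2 - (d + 1) + j` and
sends one round later. As `d ≤ D`, even the reading takes place after the token rounds `0, …, D`. -/
lemma relay_message_collect (i : ℕ) (v : V) (j : Fin R) (hv : v ≠ r)
    (hi : i + G.dist r v = 2 * D + 2 + j) :
    (relay D ident root τ).message G know x i v (par v) =
      some (collected D ident root τ G know x r v j) := by
  have h1 := hτ.dist_le v
  have h2 := hτ.dist_parent v hv
  have h3 := j.2
  have hD : D < i := by omega
  set h := (relay D ident root τ).history G know x i v with hh
  have hlen : h.length = i := Protocol.length_history ..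
  have hj : ident (know v) ≠ root (know v) ∧ par v = τ.parent (know v) h ∧
      ∃ j : Fin R, h.length + τ.depth (know v) h = 2 * D + 2 + j := by
    refine ⟨by rwa [hτ.ident_eq, hτ.root_eq], (hτ.parent_eq i v hD hv).symm, j, ?_⟩
    rwa [hlen, hτ.depth_eq i v hD]
  -- Round and depth determine the instance, so the chosen index is `j`.
  have hj' : hj.2.2.choose = j := Fin.ext (by
    have := hj.2.2.choose_spec
    have hd : τ.depth (know v) h = G.dist r v := hτ.depth_eq i v hD
    omega)
  rw [Protocol.message, if_pos (hτ.adj v hv), ← hh, relay, if_neg (by omega),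
    if_pos (by omega), dif_pos hj, hj', subtotal_eq hτ v j i hD (by omega)]

lemma relay_message_eq_none (i : ℕ) (v u : V) (hi : D < i) (hi' : i < 2 * D + 2 + R)
    (h : ¬ (v ≠ r ∧ u = par v ∧ ∃ j : Fin R, i + G.dist r v = 2 * D + 2 + j)) :
    (relay D ident root τ).message G know x i v u = none := by
  unfold Protocol.message
  split_ifs
  · rw [relay, if_neg (by rw [Protocol.length_history]; omega),
      if_pos (by rw [Protocol.length_history]; omega), dif_neg]
    rw [hτ.ident_eq, hτ.root_eq, hτ.depth_eq i v hi, Protocol.length_history]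
    rintro ⟨hv, hu, hj⟩
    rw [hτ.parent_eq i v hi hv] at hu
    exact h ⟨hv, hu, hj⟩
  · rfl

/-- In the round in question only children of `v` send to `v`: children all have the same depth, so
the values for instance `j` arrive simultaneously. -/
lemma collected_eq_add_sum (v : V) (j : Fin R) :
    collected D ident root τ G know x r v j = x v j + ∑ u, if u ≠ r ∧ v = par u then
      collected D ident root τ G know x r u j else 0 := by
  conv_lhs => unfold collected
  congr 1
  refine Finset.sum_congr rfl fun u _ => ?_
  have h1 := hτ.dist_le v
  have h3 := j.2
  split_ifs with hu
  · obtain ⟨hu, rfl⟩ := hu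
    have h2 := hτ.dist_parent u hu
    rw [relay_message_collect hτ _ u j hu (by have := hτ.dist_le u; omega)]
    rfl
  · rw [relay_message_eq_none hτ _ _ _ (by omega) (by omega)]
    · rfl
    · exact fun h => hu ⟨h.1, h.2.1⟩

/-- Sum the recursion over all nodes. Each non-root has exactly one parent, so the values of the
non-roots appear once on either side and cancel; no induction on the tree is needed. -/
lemma collected_root (j : Fin R) :
    collected D ident root τ G know x r r j = ∑ u, x u j := by
  set Y : V → Word B := fun v => collected D ident root τ G know x r v j with hY
  have h1 : ∑ v, Y v = ∑ v, x v j + ∑ u, if u ≠ r then Y u else 0 := by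
    rw [Finset.sum_congr rfl fun v _ => collected_eq_add_sum hτ v j, Finset.sum_add_distrib]
    congr 1
    rw [Finset.sum_comm]
    refine Finset.sum_congr rfl fun u _ => ?_
    by_cases hu : u = r <;> simp [hu, hY]
  have h2 : ∑ v, Y v = Y r + ∑ u, if u ≠ r then Y u else 0 := by
    have : ∀ v, Y v = (if v = r then Y r else 0) + if v ≠ r then Y v else 0 := by
      intro v
      by_cases hv : v = r <;> simp [hv]
    rw [Finset.sum_congr rfl fun v _ => this v, Finset.sum_add_distrib]
    simp
  exact add_right_cancel (h2.symm.trans h1)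

/-- Induction on the depth: a node receives from its parent what the parent knows. The second
alternative records that the root has the sum before the broadcast, which is what unicast uses. -/
lemma total_eq (hr : G.Connected) (v : V) (j : Fin R) (i : ℕ)
    (hi : 2 * D + 2 + R + G.dist r v + j ≤ i ∨ (v = r ∧ 2 * D + 2 + j ≤ i)) :
    total D ident root τ (know v) (x v) ((relay D ident root τ).history G know x i v) j =
      ∑ u, x u j := by
  have h3 := j.2
  by_cases hv : v = r
  · subst hv
    rw [total, if_pos (by rw [hτ.ident_eq, hτ.root_eq]), subtotal_eq hτ v j i (by omega) (by omega),
      collected_root hτ]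
  · have hi : 2 * D + 2 + R + G.dist r v + j ≤ i := hi.resolve_right fun h => hv h.1
    induction hd : G.dist r v generalizing v i with
    | zero => exact absurd (hr.dist_eq_zero_iff.mp hd).symm hv
    | succ d ih =>
      have hp := hτ.dist_parent v hv
      -- The parent, at depth `d`, forwards the sum in exactly the first round in which the
      -- induction hypothesis applies to it.
      have hpi : 2 * D + 2 + R + G.dist r (par v) + j ≤ 2 * D + 2 + R + d + j := by omega
      have key : total D ident root τ (know (par v)) (x (par v))
          ((relay D ident root τ).history G know x (2 * D + 2 + R + d + j) (par v)) j =
            ∑ u, x u j := by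
        by_cases hpr : par v = r
        · rw [total, if_pos (by rw [hτ.ident_eq, hτ.root_eq, hpr]),
            subtotal_eq hτ _ j _ (by omega) (by omega), hpr, collected_root hτ]
        · exact ih (par v) _ (.inl hpi) hpr hpi (by omega)
      have hj : ∃ j' : Fin R, 2 * D + 2 + R + d + (j : ℕ) = 2 * D + 2 + R + d + j' := ⟨j, rfl⟩
      have hj' : hj.choose = j := Fin.ext (by have := hj.choose_spec; omega)
      rw [total, if_neg (by rwa [hτ.ident_eq, hτ.root_eq]), hτ.depth_eq i v (by omega), hd,
        Nat.add_sub_cancel, hτ.parent_eq i v (by omega) hv, Protocol.received_history,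
        if_pos (by omega), Protocol.message, if_pos (hτ.adj v hv).symm, relay,
        if_neg (by rw [Protocol.length_history]; omega),
        if_neg (by rw [Protocol.length_history]; omega)]
      have hpd : G.dist r (par v) = d := by omega
      simp only [Protocol.length_history, hτ.depth_eq (2 * D + 2 + R + d + j) (par v) (by omega),
        hpd]
      rw [dif_pos hj, hj']
      exact key

end

end Relay

/-- The parent of `v` in a breadth-first search tree with root `r`. -/
noncomputable def bfsParent (G : SimpleGraph V) (r v : V) : V :=
  @Classical.epsilon V ⟨r⟩ fun u => G.Adj u v ∧ G.dist r u + 1 = G.dist r v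

lemma exists_adj_dist_add_one {G : SimpleGraph V} (hG : G.Connected) {r v : V} (hv : v ≠ r) :
    ∃ u, G.Adj u v ∧ G.dist r u + 1 = G.dist r v := by
  obtain ⟨q, hq⟩ := hG.exists_walk_length_eq_dist v r
  cases q with
  | nil => exact absurd rfl hv
  | @cons _ u _ h q =>
    refine ⟨u, h.symm, ?_⟩
    rw [SimpleGraph.Walk.length_cons, SimpleGraph.dist_comm] at hq
    have h1 : G.dist r u ≤ q.length := by rw [SimpleGraph.dist_comm]; exact G.dist_le q
    have h2 : G.dist r v ≤ G.dist r u + G.dist u v := hG.dist_triangle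
    rw [SimpleGraph.dist_eq_one_iff_adj.mpr h.symm] at h2
    omega

lemma bfsParent_spec {G : SimpleGraph V} (hG : G.Connected) {r v : V} (hv : v ≠ r) :
    G.Adj (bfsParent G r v) v ∧ G.dist r (bfsParent G r v) + 1 = G.dist r v :=
  Classical.epsilon_spec (exists_adj_dist_add_one hG hv)

lemma dist_le_dist_add_one {G : SimpleGraph V} (hG : G.Connected) (r : V) {u v : V}
    (h : G.Adj u v) : G.dist r v ≤ G.dist r u + 1 := by
  have h2 : G.dist r v ≤ G.dist r u + G.dist u v := hG.dist_triangle
  rwa [SimpleGraph.dist_eq_one_iff_adj.mpr h] at h2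

lemma dist_le_of_diam_eq [Finite V] {G : SimpleGraph V} (hG : G.Connected) {D : ℕ}
    (hD : G.diam = D) (u v : V) : G.dist u v ≤ D := by
  have := hG.nonempty
  exact hD ▸ SimpleGraph.dist_le_diam (SimpleGraph.connected_iff_ediam_ne_top.mp hG)

/-! ### The tree for known topology -/

section KnownTree

/-- If the topology is known, no tokens are sent. -/
noncomputable def knownTree (V : Type) (B R : ℕ) [NeZero R] :
    TreeRule V (GlobalKnowledge V R) B where
  token _ _ _ := False
  depth k _ := k.graph.dist (k.pairs.target 0) k.self
  parent k _ := bfsParent k.graph (k.pairs.target 0) k.self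

variable [Fintype V] [NeZero R] {D : ℕ}

lemma knownTree_constructs {G : SimpleGraph V} (hG : G.Connected) (hD : G.diam = D)
    (P : Pairs V R) (x : V → Fin R → Word B) :
    Constructs D GlobalKnowledge.self (fun k => k.pairs.target 0) (knownTree V B R) G
      (globalKnowledge G P) x (P.target 0) (bfsParent G (P.target 0)) where
  ident_eq _ := rfl
  root_eq _ := rfl
  dist_le _ := dist_le_of_diam_eq hG hD _ _
  adj _ hv := (bfsParent_spec hG hv).1.symm
  dist_parent _ hv := (bfsParent_spec hG hv).2
  depth_eq _ _ _ := rfl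
  parent_eq _ _ _ _ := rfl

end KnownTree

/-! ### The tree built by flooding -/

section FloodedTree

/-- Construction of a breadth-first search tree by flooding: when a node receives the first tokens,
it sends tokens to the other neighbors. -/
noncomputable def floodedTree (V : Type) (B R : ℕ) [NeZero R] :
    TreeRule V (LocalKnowledge V R) B where
  token k h v :=
    if h.length = 0 then k.self = k.pairs.target 0
    else k.self ≠ k.pairs.target 0 ∧
      sInf {i | ∃ u, (received h i u).isSome} + 1 = h.length ∧
      (∃ u, (received h (h.length - 1) u).isSome) ∧ received h (h.length - 1) v = none
  depth k h :=
    if k.self = k.pairs.target 0 then 0 else sInf {i | ∃ u, (received h i u).isSome} + 1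
  parent k h := @Classical.epsilon V ⟨k.self⟩ fun u =>
    (received h (sInf {i | ∃ u, (received h i u).isSome}) u).isSome

variable [Fintype V] [NeZero R] {D : ℕ}

/-- The protocol of a KT1 network. -/
noncomputable abbrev floodedRelay (V : Type) (B R D : ℕ) [Fintype V] [NeZero R] :
    Protocol V (LocalKnowledge V R) B R :=
  relay D LocalKnowledge.self (fun k => k.pairs.target 0) (floodedTree V B R)

section

variable {G : SimpleGraph V} (hG : G.Connected) (P : Pairs V R) (x : V → Fin R → Word B)

include hG

/-- Distances to the root change by at most one along an edge, so no token can arrive earlier, and a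
neighbor closer to the root does send one in time. The behavior of tokens is a hypothesis because
the lemma is used both inside the induction that proves it and afterwards. -/
lemma sInf_received_eq (i : ℕ) (v : V) (hv : v ≠ P.target 0)
    (hvi : G.dist (P.target 0) v ≤ i) (hvD : G.dist (P.target 0) v ≤ D)
    (ih : ∀ k < i, k ≤ D → ∀ u w,
      ((floodedRelay V B R D).message G (localKnowledge G P) x k u w).isSome ↔
        G.Adj u w ∧ G.dist (P.target 0) u = k ∧ G.dist (P.target 0) w + 1 ≠ k) :
    sInf {k | ∃ u, (received ((floodedRelay V B R D).history G (localKnowledge G P) x i v)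
      k u).isSome} + 1 = G.dist (P.target 0) v := by
  simp only [Protocol.received_history]
  obtain ⟨u, hu, hd⟩ := exists_adj_dist_add_one hG hv
  refine (congrArg (· + 1) (IsLeast.csInf_eq ⟨?_, ?_⟩)).trans hd
  · refine ⟨u, ?_⟩
    rw [if_pos (by omega), ih _ (by omega) (by omega)]
    exact ⟨hu, rfl, by omega⟩
  · rintro k ⟨w, hw⟩
    by_contra! hk
    by_cases hki : k < i
    · rw [if_pos hki, ih k hki (by omega)] at hw
      have := dist_le_dist_add_one hG (P.target 0) hw.1
      omega
    · simp [hki] at hw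

/-- A node of depth `i > 0` gets its first tokens in round `i - 1`, from precisely its neighbors of
depth `i - 1`, and then sends to all others. In particular no token goes to a parent. -/
lemma floodedRelay_message_isSome (i : ℕ) (hi : i ≤ D) (u v : V) :
    ((floodedRelay V B R D).message G (localKnowledge G P) x i u v).isSome ↔
      G.Adj u v ∧ G.dist (P.target 0) u = i ∧ G.dist (P.target 0) v + 1 ≠ i := by
  induction i using Nat.strong_induction_on generalizing u v with
  | _ i ih =>
    rw [relay_message_token i hi]
    have h0 : G.dist (P.target 0) u = 0 ↔ u = P.target 0 := by
      rw [hG.dist_eq_zero_iff]; exact eq_comm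
    have htoken : ∀ h : History V B, (floodedTree V B R).token (localKnowledge G P u) h v ↔
        if h.length = 0 then u = P.target 0
        else u ≠ P.target 0 ∧ sInf {i | ∃ u, (received h i u).isSome} + 1 = h.length ∧
          (∃ u, (received h (h.length - 1) u).isSome) ∧ received h (h.length - 1) v = none :=
      fun _ => Iff.rfl
    rw [Option.isSome_ite]
    refine and_congr_right fun hadj => ?_
    rw [htoken]
    simp only [Protocol.length_history]
    split_ifs with hi0
    · subst hi0
      simp [h0]
    · by_cases hur : u = P.target 0
      · have := h0.mpr hur
        constructor
        · exact fun h => absurd hur h.1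
        · intro h; omega
      · have hpos : G.dist (P.target 0) u ≠ 0 := fun h => hur (h0.mp h)
        have hlast : ∀ w, (received ((floodedRelay V B R D).history G (localKnowledge G P) x i u)
            (i - 1) w).isSome ↔ G.Adj w u ∧ G.dist (P.target 0) w = i - 1 ∧
              G.dist (P.target 0) u + 1 ≠ i - 1 := by
          intro w
          rw [Protocol.received_history, if_pos (by omega), ih _ (by omega) (by omega)]
        rw [← Option.not_isSome_iff_eq_none, hlast]
        simp only [hlast]
        constructor
        -- The sender `w` bounds the depth of `u` by `i`. Without it, `sInf ∅ = 0` could pass for an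
        -- arrival in round `0`.
        · rintro ⟨_, h1, ⟨w, hw, hwd, _⟩, h2⟩
          have hui := dist_le_dist_add_one hG (P.target 0) hw
          rw [sInf_received_eq hG P x i u hur (by omega) (by omega)
            (fun k hk hkD u w => ih k hk hkD u w)] at h1
          refine ⟨h1, fun h => h2 ⟨hadj.symm, by omega, by omega⟩⟩
        · rintro ⟨h1, h2⟩
          refine ⟨hur, ?_, ?_, fun h => by omega⟩
          · rw [sInf_received_eq hG P x i u hur (by omega) (by omega)
              (fun k hk hkD u w => ih k hk hkD u w), h1]
          · obtain ⟨w, hw, hd⟩ := exists_adj_dist_add_one hG hur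
            exact ⟨w, hw, by omega, by omega⟩

lemma floodedTree_constructs (hD : G.diam = D) :
    Constructs D LocalKnowledge.self (fun k => k.pairs.target 0) (floodedTree V B R) G
      (localKnowledge G P) x (P.target 0) (bfsParent G (P.target 0)) := by
  have hdist := dist_le_of_diam_eq hG hD (P.target 0)
  have hinf : ∀ i v, D < i → v ≠ P.target 0 →
      sInf {k | ∃ u, (received ((floodedRelay V B R D).history G (localKnowledge G P) x i v)
        k u).isSome} + 1 = G.dist (P.target 0) v := fun i v hi hv =>
    sInf_received_eq hG P x i v hv (by have := hdist v; omega) (hdist v)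
      (fun k _ hk => floodedRelay_message_isSome hG P x k hk)
  refine ⟨fun _ => rfl, fun _ => rfl, hdist, fun _ hv => (bfsParent_spec hG hv).1.symm,
    fun _ hv => (bfsParent_spec hG hv).2, fun i v hi => ?_, fun i v hi hv => ?_⟩
  · by_cases hv : v = P.target 0
    · subst hv
      simp [floodedTree, localKnowledge]
    · exact (if_neg hv).trans (hinf i v hi hv)
  · have h1 := Nat.eq_sub_of_add_eq (hinf i v hi hv)
    have h2 := hdist v
    change @Classical.epsilon V ⟨v⟩ (fun u => (received _ (sInf {k | ∃ u, (received
      ((floodedRelay V B R D).history G (localKnowledge G P) x i v) k u).isSome}) u).isSome) = _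
    rw [h1]
    -- The senders of the first tokens are exactly the candidates in `bfsParent`. The choice
    -- operator sees the same predicate and thus picks the same node; the two proofs of nonemptiness
    -- are irrelevant.
    change _ = @Classical.epsilon V ⟨P.target 0⟩ _
    congr 1
    funext u
    have h3 : G.dist (P.target 0) v ≠ 0 := fun h => hv (hG.dist_eq_zero_iff.mp h).symm
    rw [Protocol.received_history, if_pos (by omega),
      floodedRelay_message_isSome hG P x _ (by omega)]
    refine propext (and_congr_right fun _ => ?_)
    omega

end

end FloodedTree

end

end MobileUnicast

/-! ### Congestion, and the final algorithms -/

namespace MobileUnicast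

section

open Classical

variable {V K : Type} {B R : ℕ}

lemma Algorithm.load_le_card (A : Algorithm V K B R) (G : SimpleGraph V) (know : V → K)
    (P : Pairs V R) (m : Fin R → Word B) (ω : V → A.Seed) (u v : V) (S : Finset ℕ)
    (hS : ∀ i < A.rounds, (A.message G know P m ω i u v).isSome → i ∈ S) :
    A.load G know P m ω u v ≤ S.card := by
  refine Finset.card_le_card fun i hi => ?_
  rw [Finset.mem_filter, Finset.mem_range] at hi
  exact hS i hi.1 hi.2

variable [Fintype V] {D : ℕ} {ident root : K → V} {τ : TreeRule V K B}

/-- The algorithm for the tree rule `τ`. -/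
noncomputable abbrev relayAlgorithm (D : ℕ) (loc : K → LocalKnowledge V R) (root : K → V)
    (τ : TreeRule V K B) (T : ℕ) : Algorithm V K B R :=
  maskedAlgorithm loc T (relay D (fun k => (loc k).self) root τ)
    (total D (fun k => (loc k).self) root τ)

lemma relayAlgorithm_correct {G : SimpleGraph V} (hG : G.Connected) {know : V → K}
    {P : Pairs V R} {loc : K → LocalKnowledge V R} (hloc : ∀ v, loc (know v) = localKnowledge G P v)
    {T : ℕ} {r : V} {par : V → V}
    (hτ : ∀ x : V → Fin R → Word B, Constructs D (fun k => (loc k).self) root τ G know x r par)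
    (hT : 2 * D + 2 + R ≤ T) (hT' : (∀ j, P.target j = r) ∨ 2 * D + 2 + R + D + R ≤ T) :
    (relayAlgorithm D loc root τ T).Correct G know P := by
  refine maskedAlgorithm_correct hloc _ _ _ fun x j => total_eq (hτ x) hG _ j T ?_
  have := (hτ x).dist_le (P.target j)
  have := j.2
  rcases hT' with h | h
  · exact .inr ⟨h j, by omega⟩
  · exact .inl (by omega)

/-- For one instance an arc carries only a key, tokens, or a value on its way to the parent: the
algorithm stops before the broadcast would begin. The round `2 * D + 3 - G.dist r u` is `2 * D + 2 -
G.dist r u` shifted by the single key round. -/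
lemma relayAlgorithm_message_isSome {G : SimpleGraph V} {know : V → K}
    {P : Pairs V 1} {loc : K → LocalKnowledge V 1} (hloc : ∀ v, loc (know v) = localKnowledge G P v)
    {r : V} {par : V → V}
    (hτ : ∀ x : V → Fin 1 → Word B, Constructs D (fun k => (loc k).self) root τ G know x r par)
    (m : Fin 1 → Word B) (ω : V → Fin 1 → V → Word B) (i : ℕ) (hi : i < 1 + (2 * D + 2 + 1))
    (u v : V)
    (h : ((relayAlgorithm D loc root τ (2 * D + 2 + 1)).message G know P m ω i u v).isSome) :
    (i = 0 ∧ WellOrderingRel u v) ∨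
    (∃ k ≤ D, i = 1 + k ∧ ((relay D (fun k => (loc k).self) root τ).message G know
      (nodePublicShare G P m ω) k u v).isSome) ∨
    (u ≠ r ∧ v = par u ∧ i = 2 * D + 3 - G.dist r u) := by
  obtain rfl | hi0 := Nat.eq_zero_or_pos i
  · have h1 := maskedAlgorithm_message_lt hloc (2 * D + 2 + 1)
      (relay D (fun k => (loc k).self) root τ) (total D (fun k => (loc k).self) root τ) m ω 0 u v
    rw [Fin.val_zero] at h1
    rw [h1] at h
    by_cases huv : G.Adj u v ∧ WellOrderingRel u v
    · exact .inl ⟨rfl, huv.2⟩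
    · simp [huv] at h
  · obtain ⟨k, rfl⟩ := Nat.exists_eq_add_of_le hi0
    have h1 := maskedAlgorithm_message_add hloc (2 * D + 2 + 1)
      (relay D (fun k => (loc k).self) root τ) (total D (fun k => (loc k).self) root τ) m ω k u v
    change ((relayAlgorithm D loc root τ (2 * D + 2 + 1)).message G know P m ω (1 + k) u v).isSome
      at h
    rw [h1] at h
    by_cases hk : k ≤ D
    · exact .inr (.inl ⟨k, hk, rfl, h⟩)
    · by_contra! hcon
      rw [relay_message_eq_none (hτ _) k u v (by omega) (by omega)] at h
      · simp at h
      · rintro ⟨hu, hv, j, hj⟩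
        exact hcon.2.2 hu hv (by omega)

/-- The knowledge of a node in the KT1 setting, extracted from its knowledge of the topology. -/
def GlobalKnowledge.toLocal (k : GlobalKnowledge V R) : LocalKnowledge V R :=
  ⟨k.self, k.graph.neighborSet k.self, k.pairs⟩

/-- The algorithm for known topology: the messages are collected along a known tree. -/
noncomputable abbrev knownAlgorithm (V : Type) [Fintype V] (B D : ℕ) :
    Algorithm V (GlobalKnowledge V 1) B 1 :=
  relayAlgorithm D GlobalKnowledge.toLocal (fun k => k.pairs.target 0) (knownTree V B 1) (2 * D + 2 + 1)

/-- The algorithm for the KT1 setting with `R + T` rounds. -/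
noncomputable abbrev floodedAlgorithm (V : Type) [Fintype V] (B R D T : ℕ) [NeZero R] :
    Algorithm V (LocalKnowledge V R) B R :=
  relayAlgorithm D id (fun k => k.pairs.target 0) (floodedTree V B R) T

/-- The key travels in one direction only, and two nodes cannot be parents of each other because
depth decreases towards the parent. -/
lemma knownAlgorithm_congestion {G : SimpleGraph V} (hG : G.Connected) (hD : G.diam = D)
    (P : Pairs V 1) :
    (knownAlgorithm V B D).HasEdgeCongestion G (globalKnowledge G P) P 2 := by
  intro m ω u v _
  set par := bfsParent G (P.target 0) with hpar
  have hload : ∀ u v, (knownAlgorithm V B D).load G (globalKnowledge G P) P m ω u v ≤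
      (if WellOrderingRel u v then 1 else 0) + (if u ≠ P.target 0 ∧ v = par u then 1 else 0) := by
    intro u v
    refine (Algorithm.load_le_card _ _ _ _ _ _ _ _
      ((if WellOrderingRel u v then {0} else ∅) ∪
        (if u ≠ P.target 0 ∧ v = par u then {2 * D + 3 - G.dist (P.target 0) u} else ∅))
      fun i hi h => ?_).trans ((Finset.card_union_le _ _).trans (add_le_add ?_ ?_))
    · rcases relayAlgorithm_message_isSome (know := globalKnowledge G P)
        (loc := GlobalKnowledge.toLocal) (fun _ => rfl) (knownTree_constructs hG hD P) m ω i hi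
        u v h with ⟨h1, h2⟩ | ⟨k, hk, -, h1⟩ | ⟨h1, h2, h3⟩
      · simp [h1, h2]
      · rw [relay_message_token k hk, if_neg (fun h => h.2)] at h1
        simp at h1
      · rw [Finset.mem_union, if_pos ⟨h1, h2⟩ (c := u ≠ P.target 0 ∧ v = par u)]
        simp [h3]
    · split_ifs <;> simp
    · split_ifs <;> simp
  have h1 := hload u v
  have h2 := hload v u
  have h3 : ¬ (WellOrderingRel u v ∧ WellOrderingRel v u) := fun h => asymm_of _ h.1 h.2
  have h4 : ¬ ((u ≠ P.target 0 ∧ v = par u) ∧ (v ≠ P.target 0 ∧ u = par v)) := by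
    rintro ⟨⟨hu, hv⟩, hv', hu'⟩
    have h5 := (bfsParent_spec hG hu).2
    have h6 := (bfsParent_spec hG hv').2
    rw [← hpar, ← hv] at h5
    rw [← hpar, ← hu'] at h6
    omega
  split_ifs at h1 h2 <;> first | omega | exact absurd ⟨‹_›, ‹_›⟩ h3 | exact absurd ⟨‹_›, ‹_›⟩ h4

lemma floodedAlgorithm_congestion {G : SimpleGraph V} (hG : G.Connected) (hD : G.diam = D)
    (P : Pairs V 1) :
    (floodedAlgorithm V B 1 D (2 * D + 2 + 1)).HasArcCongestion G (localKnowledge G P) P 2 := by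
  intro m ω u v _
  -- Besides round `0` for the key, an arc to the parent is used only for the collected value and
  -- any other arc only for a token.
  refine (Algorithm.load_le_card _ _ _ _ _ _ _ _ {0, if u ≠ P.target 0 ∧
    v = bfsParent G (P.target 0) u then 2 * D + 3 - G.dist (P.target 0) u
      else 1 + G.dist (P.target 0) u} fun i hi h => ?_).trans Finset.card_le_two
  rcases relayAlgorithm_message_isSome (know := localKnowledge G P) (loc := id) (fun _ => rfl)
    (fun x => floodedTree_constructs hG P x hD) m ω i hi u v h with
    ⟨h1, -⟩ | ⟨k, hk, rfl, h1⟩ | ⟨h1, h2, h3⟩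
  · simp [h1]
  · have h1 := (floodedRelay_message_isSome hG P _ k hk u v).mp h1
    rw [if_neg]
    · simp [h1.2.1]
    · rintro ⟨hu, rfl⟩
      have := (bfsParent_spec hG hu).2
      omega
  · rw [if_pos ⟨h1, h2⟩]
    simp [h3]

lemma knownAlgorithm_correct {G : SimpleGraph V} (hG : G.Connected) (hD : G.diam = D)
    (P : Pairs V 1) : (knownAlgorithm V B D).Correct G (globalKnowledge G P) P :=
  relayAlgorithm_correct hG (know := globalKnowledge G P) (loc := GlobalKnowledge.toLocal)
    (fun _ => rfl) (knownTree_constructs hG hD P) le_rfl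
    (.inl fun j => by rw [Subsingleton.elim j 0])

lemma knownAlgorithm_mobileSecure (G : SimpleGraph V) (P : Pairs V 1) :
    (knownAlgorithm V B D).MobileSecure G (globalKnowledge G P) P :=
  maskedAlgorithm_mobileSecure (know := globalKnowledge G P) (loc := GlobalKnowledge.toLocal)
    (fun _ => rfl) _ _ _

lemma floodedAlgorithm_correct [NeZero R] {T : ℕ} {G : SimpleGraph V} (hG : G.Connected)
    (hD : G.diam = D) (P : Pairs V R) (hT : 2 * D + 2 + R ≤ T)
    (hT' : (∀ j, P.target j = P.target 0) ∨ 2 * D + 2 + R + D + R ≤ T) :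
    (floodedAlgorithm V B R D T).Correct G (localKnowledge G P) P :=
  relayAlgorithm_correct hG (know := localKnowledge G P) (loc := id) (fun _ => rfl)
    (fun x => floodedTree_constructs hG P x hD) hT hT'

lemma floodedAlgorithm_mobileSecure [NeZero R] {T : ℕ} (G : SimpleGraph V) (P : Pairs V R) :
    (floodedAlgorithm V B R D T).MobileSecure G (localKnowledge G P) P :=
  maskedAlgorithm_mobileSecure (know := localKnowledge G P) (loc := id) (fun _ => rfl) _ _ _

lemma subsingleton_of_diam_eq_zero {G : SimpleGraph V} (hG : G.Connected) (hD : G.diam = 0)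
    (u v : V) : u = v :=
  hG.dist_eq_zero_iff.mp (Nat.le_zero.mp (dist_le_of_diam_eq hG hD u v))

end

end MobileUnicast

theorem mainTheorem11 :
    ∃ c : ℕ, ∀ (V : Type) [Fintype V] (D B : ℕ),
      -- unicast, known topology: at most two messages per edge
      (∃ A : MobileUnicast.Algorithm V (MobileUnicast.GlobalKnowledge V 1) B 1,
        A.rounds ≤ c * D ∧
        ∀ G : SimpleGraph V, G.Connected → G.diam = D → ∀ (s t : V),
          A.HasEdgeCongestion G
            (MobileUnicast.globalKnowledge G (.single s t)) (.single s t) 2 ∧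
          A.Correct G (MobileUnicast.globalKnowledge G (.single s t)) (.single s t) ∧
          A.MobileSecure G (MobileUnicast.globalKnowledge G (.single s t)) (.single s t)) ∧
      -- unicast, KT1: at most two messages per edge and direction
      (∃ A : MobileUnicast.Algorithm V (MobileUnicast.LocalKnowledge V 1) B 1,
        A.rounds ≤ c * D ∧
        ∀ G : SimpleGraph V, G.Connected → G.diam = D → ∀ (s t : V),
          A.HasArcCongestion G
            (MobileUnicast.localKnowledge G (.single s t)) (.single s t) 2 ∧
          A.Correct G (MobileUnicast.localKnowledge G (.single s t)) (.single s t) ∧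
          A.MobileSecure G (MobileUnicast.localKnowledge G (.single s t)) (.single s t)) ∧
      -- `R` unicasts in parallel, KT1
      (∀ R : ℕ, ∃ A : MobileUnicast.Algorithm V (MobileUnicast.LocalKnowledge V R) B R,
        A.rounds ≤ c * (D + R) ∧
        ∀ G : SimpleGraph V, G.Connected → G.diam = D → ∀ P : MobileUnicast.Pairs V R,
          A.Correct G (MobileUnicast.localKnowledge G P) P ∧
          A.MobileSecure G (MobileUnicast.localKnowledge G P) P) := by
  open MobileUnicast in
  -- Unicast takes `2 * D + 4` rounds, at most `6 * D` if `D ≥ 1` (tight for `D = 1`). For `D = 0`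
  -- no round is allowed, but then the network is a single node.
  refine ⟨6, fun V _ D B => ⟨?_, ?_, fun R => ?_⟩⟩
  · obtain rfl | hD := Nat.eq_zero_or_pos D
    · refine ⟨silentAlgorithm V _ B 1, le_rfl, fun G hG hD s t => ⟨fun m ω u v _ => ?_,
        silentAlgorithm_correct _ _ _ fun _ => subsingleton_of_diam_eq_zero hG hD _ _,
        silentAlgorithm_mobileSecure _ _ _⟩⟩
      simp [silentAlgorithm_load]
    · refine ⟨knownAlgorithm V B D, ?_, fun G hG hD s t => ⟨knownAlgorithm_congestion hG hD _,
        knownAlgorithm_correct hG hD _, knownAlgorithm_mobileSecure _ _⟩⟩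
      change 1 + (2 * D + 2 + 1) ≤ 6 * D
      omega
  · obtain rfl | hD := Nat.eq_zero_or_pos D
    · refine ⟨silentAlgorithm V _ B 1, le_rfl, fun G hG hD s t => ⟨fun m ω u v _ => ?_,
        silentAlgorithm_correct _ _ _ fun _ => subsingleton_of_diam_eq_zero hG hD _ _,
        silentAlgorithm_mobileSecure _ _ _⟩⟩
      simp [silentAlgorithm_load]
    · refine ⟨floodedAlgorithm V B 1 D (2 * D + 2 + 1), ?_, fun G hG hD s t =>
        ⟨floodedAlgorithm_congestion hG hD _,
        floodedAlgorithm_correct hG hD _ le_rfl (.inl fun _ => rfl),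
        floodedAlgorithm_mobileSecure _ _⟩⟩
      change 1 + (2 * D + 2 + 1) ≤ 6 * D
      omega
  · obtain rfl | hR := Nat.eq_zero_or_pos R
    · exact ⟨silentAlgorithm V _ B 0, Nat.zero_le _, fun G _ _ P =>
        ⟨silentAlgorithm_correct _ _ _ fun j => j.elim0, silentAlgorithm_mobileSecure _ _ _⟩⟩
    · have : NeZero R := ⟨hR.ne'⟩
      refine ⟨floodedAlgorithm V B R D (2 * D + 2 + R + D + R), ?_, fun G hG hD P =>
        ⟨floodedAlgorithm_correct hG hD P (by omega) (.inr le_rfl),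
        floodedAlgorithm_mobileSecure _ _⟩⟩
      change R + (2 * D + 2 + R + D + R) ≤ 6 * (D + R)
      omega
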